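/- **Setting.** Let $d\ge 0$, $q\ge 1$ be integers and $D_k=\{1,\dots,q\}^k$. A *Moran construction* in $\mathbb R^d$ consists of a nonempty set $\Delta\subset\mathbb R^d$ and maps $f_{k,i}:\mathbb R^d\to\mathbb R^d$ ($k\ge1$, $1\le i\le q$), each of which has a nonempty compact set $A$ with $f(A)\subset A$ and $\operatorname{diam} f^m(B)\to0$ as $m\to\infty$ for all compact $B\subset A$ (contractions are examples), such that the sets $\Delta_\omega=f_{1,i_1}\circ\cdots\circ f_{k,i_k}(\Delta)$, $\omega=(i_1,\dots,i_k)\in D_k$, $k\ge 0$, are compact, satisfy $\Delta_{\omega*j}\subset\Delta_\omega$, and $\max_{\omega\in D_k}\operatorname{diam}\Delta_\omega\to0$ as $k\to\infty$. Its limit set is $F=\bigcap_k\bigcup_{\omega\in D_k}\Delta_\omega$. It is *weakly separated* if $\Delta_\omega\cap\Delta_{\omega'}\cap F=\emptyset$ for all $k$ and all $\omega\ne\omega'$ in $D_k$ (then $F$ is called a generalized Moran set). Given numbers $c_j\ge0$ ($j\ge1$), put $\Psi^{(k)}_\omega=\prod_{j=1}^k c_j$ for $\omega\in D_k$, with $\Psi^{(0)}=1$.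 The vector $\Psi$ is * *basic* if $\sup_j c_j<1$; * (UE) if there is $C>0$ with $\operatorname{diam}\Delta_\omega\le C\,\Psi^{(k)}_\omega$ for all $k$ and $\omega\in D_k$; * (LE) if there is $M$ such that for all $x\in F$ and $0<r<1$ the open ball $B(x,r)$ meets fewer than $M$ elements of the Moran covering at scale $r$. This covering consists of the sets of those points of $F$ that are coded by an infinite word with the same first $k$ letters as $w$, where $w$ runs over the infinite words and $k\ge0$ is such that $\Psi^{(k)}_{w_1\cdots w_k}>r\ge\Psi^{(k+1)}_{w_1\cdots w_{k+1}}$; a point $y$ is coded by $w$ if $y\in\Delta_{w_1\cdots w_k}$ for all $k$. Condition (A3): for every $\beta>0$ there are a finite Borel measure $m$ on $\mathbb R^d$ with $m(\mathbb R^d\setminus F)=0$ and a constant $L>0$ such that for all $k\ge1$, $\omega\in D_k$, $$\frac{L^{-1}}{\sum_{\omega'\in D_k}(\Psi^{(k)}_{\omega'})^{\beta}}\le\frac{m(\Delta_\omega)}{(\Psi^{(k)}_\omega)^{\beta}}\le\frac{L}{\sum_{\omega'\in D_k}(\Psi^{(k)}_{\omega'})^{\beta}}.$$ **Theorem.** Let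 $(M,\mu)$ be a probability space, $T:M\to M$ measure preserving and ergodic, and $\phi:M\to[0,1)$ with $\phi>0$ $\mu$-a.e., $\log\phi\in L^1(\mu)$ and $\int\log\phi\,d\mu<0$. Let $d\ge 0$ and $q\ge1$. Then for $\mu$-a.e. $x\in M$ the following holds: for every weakly separated Moran construction in $\mathbb R^d$ with $q$ branches at each step for which the vector $\Psi^{(k)}_\omega=\prod_{j=1}^k\phi(T^jx)$ is basic and satisfies (UE), (LE) and (A3), the limit set $F$ has $$\dim_H F=\dim_P F=\overline{\dim}_B F=\frac{-\log q}{\int\log\phi\,d\mu}.$$ Here $\dim_H$, $\dim_P$ and $\overline{\dim}_B$ are the Hausdorff, packing and upper box dimensions. -/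

import Mathlib

open Filter Topology MeasureTheory
open scoped NNReal ENNReal

noncomputable section

namespace MoranSet

/-! ### Fractal dimensions -/

/-- The quantity `P^s_ε(A)`: the supremum of `∑ diam (B_i) ^ s` over families of disjoint balls of
radius at most `ε` with centres in `A`. A ball is given by the pair (centre, radius); the supremum
over finite families is the same as the one over countable families. -/
def prePackingScale {X : Type*} [MetricSpace X] (s ε : ℝ) (A : Set X) : ℝ≥0∞ :=
  ⨆ (P : Finset (X × ℝ))
    (_ : (∀ p ∈ P, p.1 ∈ A ∧ 0 < p.2 ∧ p.2 ≤ ε) ∧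
      (P : Set (X × ℝ)).PairwiseDisjoint (fun p => Metric.closedBall p.1 p.2)),
    ∑ p ∈ P, Metric.ediam (Metric.closedBall p.1 p.2) ^ s

/-- The packing premeasure `P^s_0(A) = lim_{ε → 0} P^s_ε(A)`; the limit is decreasing. -/
def prePacking {X : Type*} [MetricSpace X] (s : ℝ) (A : Set X) : ℝ≥0∞ :=
  ⨅ (ε : ℝ) (_ : 0 < ε), prePackingScale s ε A

/-- The `s`-dimensional packing measure. -/
def packingMeasure {X : Type*} [MetricSpace X] (s : ℝ) (A : Set X) : ℝ≥0∞ :=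
  ⨅ (U : ℕ → Set X) (_ : A ⊆ ⋃ i, U i), ∑' i, prePacking s (U i)

/-- The packing dimension `sup {s ≥ 0 : P^s(A) = ∞}`. -/
def packingDim {X : Type*} [MetricSpace X] (A : Set X) : ℝ≥0∞ :=
  ⨆ (s : ℝ≥0) (_ : packingMeasure (s : ℝ) A = ∞), (s : ℝ≥0∞)

/-- The upper box dimension `limsup_{ε → 0} log N(ε) / log (1 / ε)`, where `N(ε)` is the smallest
number of balls of radius `ε` needed to cover `A`. -/
def upperBoxDim {X : Type*} [MetricSpace X] (A : Set X) : EReal :=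
  limsup (fun ε : ℝ≥0 =>
      ENNReal.log ((Metric.externalCoveringNumber ε A : ℕ∞) : ℝ≥0∞) /
        ((Real.log (1 / (ε : ℝ)) : ℝ) : EReal))
    (𝓝[>] 0)

/-! ### Words

Steps are numbered from `0`: step `j` here is step `j + 1` of the usual numbering, and `n j` is the
number of branches at that step. -/

/-- `D_k`: the words of length `k`. -/
abbrev Word (n : ℕ → ℕ) (k : ℕ) : Type := (j : Fin k) → Fin (n j)

/-- `D^*`: the infinite words. -/
abbrev Code (n : ℕ → ℕ) : Type := (j : ℕ) → Fin (n j)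

/-- A word without its last letter. -/
def Word.init {n : ℕ → ℕ} {k : ℕ} (ω : Word n (k + 1)) : Word n k := fun j => ω j.castSucc

/-- The last letter of a word. -/
def Word.last {n : ℕ → ℕ} {k : ℕ} (ω : Word n (k + 1)) : Fin (n k) := ω (Fin.last k)

/-- The first `k` letters of an infinite word. -/
def Code.take {n : ℕ → ℕ} (w : Code n) (k : ℕ) : Word n k := fun j => w j

/-! ### Moran structures -/

/-- The class of maps `f : ℝ^d → ℝ^d` that have a (nonempty) compact forward invariant set `A` such
that `diam (f^n (B)) → 0` for every compact `B ⊆ A`. Every contraction belongs to it. -/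
def AsymptoticallyContracting {d : ℕ}
    (f : EuclideanSpace ℝ (Fin d) → EuclideanSpace ℝ (Fin d)) : Prop :=
  ∃ A : Set (EuclideanSpace ℝ (Fin d)), A.Nonempty ∧ IsCompact A ∧ f '' A ⊆ A ∧
    ∀ B ⊆ A, IsCompact B → Tendsto (fun m : ℕ => Metric.diam (f^[m] '' B)) atTop (𝓝 0)

/-- For `ω = (i_1, …, i_k)`, the composition `f_ω = f_{1,i_1} ∘ f_{2,i_2} ∘ ⋯ ∘ f_{k,i_k}`. -/
def wordMap {d : ℕ} {n : ℕ → ℕ}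
    (f : (j : ℕ) → Fin (n j) → EuclideanSpace ℝ (Fin d) → EuclideanSpace ℝ (Fin d)) :
    (k : ℕ) → Word n k → EuclideanSpace ℝ (Fin d) → EuclideanSpace ℝ (Fin d)
  | 0, _ => id
  | k + 1, ω => wordMap f k ω.init ∘ f k ω.last

/-- A Moran construction in `ℝ^d` with `n j` branches at step `j`: an initial set `Δ`, maps
`f_{j,i}`, and the sets `Δ_ω = f_ω(Δ)`, which are compact, nested along words, and whose
diameters tend to `0` uniformly over the words of length `k` as `k → ∞`. -/
structure MoranConstruction (d : ℕ) (n : ℕ → ℕ) where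
  base : Set (EuclideanSpace ℝ (Fin d))
  base_nonempty : base.Nonempty
  map : (j : ℕ) → Fin (n j) → EuclideanSpace ℝ (Fin d) → EuclideanSpace ℝ (Fin d)
  map_mem : ∀ j i, AsymptoticallyContracting (map j i)
  isCompact_image : ∀ (k : ℕ) (ω : Word n k), IsCompact (wordMap map k ω '' base)
  nested : ∀ (k : ℕ) (ω : Word n (k + 1)),
    wordMap map (k + 1) ω '' base ⊆ wordMap map k ω.init '' base
  diam_tendsto : ∀ ε > 0, ∃ K : ℕ, ∀ k ≥ K, ∀ ω : Word n k,
    Metric.diam (wordMap map k ω '' base) ≤ ε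

namespace MoranConstruction

variable {d : ℕ} {n : ℕ → ℕ}

/-- The set `Δ_ω = f_ω(Δ)`. -/
def basicSet (S : MoranConstruction d n) {k : ℕ} (ω : Word n k) :
    Set (EuclideanSpace ℝ (Fin d)) :=
  wordMap S.map k ω '' S.base

/-- The limit set `F = ⋂_k ⋃_{ω ∈ D_k} Δ_ω`. -/
def limitSet (S : MoranConstruction d n) : Set (EuclideanSpace ℝ (Fin d)) :=
  ⋂ k : ℕ, ⋃ ω : Word n k, S.basicSet ω

/-- The weak separation condition: distinct sets of the same level do not meet inside `F`. With it
`F` is a generalized Moran set. -/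
def WeaklySeparated (S : MoranConstruction d n) : Prop :=
  ∀ (k : ℕ) (ω ω' : Word n k), ω ≠ ω' → (S.basicSet ω ∩ S.basicSet ω') ∩ S.limitSet = ∅

/-- `x` is the point of `F` coded by the infinite word `w`. -/
def IsCodedBy (S : MoranConstruction d n) (x : EuclideanSpace ℝ (Fin d)) (w : Code n) : Prop :=
  ∀ k : ℕ, x ∈ S.basicSet (w.take k)

/-- The image in `F` of the cylinder of length `k` around the infinite word `w`. -/
def cylinderImage (S : MoranConstruction d n) (w : Code n) (k : ℕ) :
    Set (EuclideanSpace ℝ (Fin d)) :=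
  {y | ∃ w' : Code n, w'.take k = w.take k ∧ S.IsCodedBy y w'}

end MoranConstruction

/-! ### Estimating vectors -/

/-- `Ψ^{(k)}(ω) = ∏_{j ≤ k} c^{(j)}_{i_j}`, for `ω = (i_1, …, i_k)`. -/
def vec {n : ℕ → ℕ} (c : (j : ℕ) → Fin (n j) → ℝ) {k : ℕ} (ω : Word n k) : ℝ :=
  ∏ j : Fin k, c j (ω j)

/-- The collection of vectors is basic: `sup_{j,i} c^{(j)}_i < 1`. -/
def IsBasic {n : ℕ → ℕ} (c : (j : ℕ) → Fin (n j) → ℝ) : Prop :=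
  ∃ ρ < 1, ∀ j i, c j i ≤ ρ

variable {d : ℕ} {n : ℕ → ℕ}

/-- The vectors are upper estimating (UE). -/
def IsUpperEstimating (S : MoranConstruction d n) (c : (j : ℕ) → Fin (n j) → ℝ) : Prop :=
  ∃ C > 0, ∀ (k : ℕ) (ω : Word n k), Metric.diam (S.basicSet ω) ≤ C * vec c ω

/-- The Moran covering of `F` at scale `r`: the images of the cylinders of length `k` around those
infinite words `w` for which `Ψ^{(k)}_w > r ≥ Ψ^{(k+1)}_w`. -/
def moranCovering (S : MoranConstruction d n) (c : (j : ℕ) → Fin (n j) → ℝ) (r : ℝ) :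
    Set (Set (EuclideanSpace ℝ (Fin d))) :=
  {P | ∃ (w : Code n) (k : ℕ),
    r < vec c (w.take k) ∧ vec c (w.take (k + 1)) ≤ r ∧ P = S.cylinderImage w k}

/-- The vectors are lower estimating (LE): for `0 < r < 1` every ball `B(x, r)` with centre in `F`
meets fewer than `M` elements of the Moran covering at scale `r`. -/
def IsLowerEstimating (S : MoranConstruction d n) (c : (j : ℕ) → Fin (n j) → ℝ) : Prop :=
  ∃ M : ℕ, ∀ x ∈ S.limitSet, ∀ r : ℝ, 0 < r → r < 1 →
    {P ∈ moranCovering S c r | (P ∩ Metric.ball x r).Nonempty}.encard < (M : ℕ∞)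

/-- Existence of Gibbs-like measures (A3): for every `β > 0` there are a finite Borel measure
carried by `F` and `L > 0` such that the measure of `Δ_ω` is comparable, up to the factor `L`, to
`Ψ(ω)^β / ∑_{ω' ∈ D_k} Ψ(ω')^β`, for all `k ≥ 1` and all `ω ∈ D_k`. -/
def HasGibbsLikeMeasures (S : MoranConstruction d n) (c : (j : ℕ) → Fin (n j) → ℝ) : Prop :=
  ∀ β : ℝ, 0 < β → ∃ m : Measure (EuclideanSpace ℝ (Fin d)), IsFiniteMeasure m ∧
    m (S.limitSetᶜ) = 0 ∧ ∃ L : ℝ, 0 < L ∧ ∀ k : ℕ, 1 ≤ k → ∀ ω : Word n k,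
      L⁻¹ / (∑ ω' : Word n k, vec c ω' ^ β) ≤ m.real (S.basicSet ω) / vec c ω ^ β ∧
      m.real (S.basicSet ω) / vec c ω ^ β ≤ L / (∑ ω' : Word n k, vec c ω' ^ β)

/-- The homogeneous stochastic ratios `c^{(j)}_i = φ(T^j x)`, `j ≥ 1`, the same for all branches
`i`, so that `Ψ^{(k)}_ω = ∏_{j=1}^k φ(T^j x)` for all `ω ∈ D_k`. -/
def stochasticRatios {M : Type*} (T : M → M) (φ : M → ℝ) (x : M) (n : ℕ → ℕ) :
    (j : ℕ) → Fin (n j) → ℝ :=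
  fun j _ => φ (T^[j + 1] x)

end MoranSet

end

/-!
Let `ψ_k = ∏_{j ≤ k} φ (T^j x)` and `λ = -∫ log φ dμ > 0`. By Birkhoff's pointwise ergodic theorem
(`ae_tendsto_birkhoffAverage`), `log ψ_k ∼ -λ k` for almost every `x`. This limit, with `ψ_k > 0`,
is all that is used about `x`, so the exceptional null set does not depend on the construction.

Fix such an `x` and a construction. Since `Ψ_ω = ψ_k` for every `ω ∈ D_k`, condition (A3) gives a
finite measure `m` on `F` with `m (Δ_ω)` comparable to `q ^ (-k)`, whatever the exponent. With
`D = log q / λ`, the asymptotics of `ψ_k` say that `q ^ (-k)` is `ψ_k ^ D` up to an arbitrarily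
small error in the exponent, and this turns into two bounds for the masses of balls centred in `F`.

* Lower bound: by (UE) the ball of radius `r` around `x ∈ Δ_ω` contains `Δ_ω` as soon as
  `C ψ_k ≤ r`, so its mass is at least `r ^ t` up to a constant, for every `t > D`
  (`exists_rpow_le_mul_measureReal_closedBall`).
* Upper bound: by (LE) the ball meets boundedly many elements of the Moran covering at scale `r`,
  and these cover `F` since weak separation lets every point be coded; so its mass is at most
  `r ^ s` up to a constant, for every `s < D` (`exists_measureReal_closedBall_le`).

Such a measure determines all dimensions (`dimensions_eq_of_ballMass`). The lower bound on masses
limits the number of disjoint balls with centres in `F`, which gives the upper bounds for the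
dimensions; the upper bound on masses is the hypothesis of the mass distribution principle, which
gives the lower bounds, also for the packing dimension, for which one uses maximal separated subsets
of the pieces of a countable cover of `F`.
-/

/-! ### The pointwise ergodic theorem -/

/-- The maximum of the Birkhoff sums `S_0 f, …, S_n f`, computed from the recursion
`max_{k ≤ n + 1} S_k f = max (0, f + (max_{k ≤ n} S_k f) ∘ T)`. -/
noncomputable def maxBirkhoffSum {M : Type*} (T : M → M) (f : M → ℝ) : ℕ → M → ℝ
  | 0, _ => 0
  | n + 1, x => max 0 (f x + maxBirkhoffSum T f n (T x))

section Birkhoff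

variable {M : Type*} {T : M → M} {f : M → ℝ}

lemma maxBirkhoffSum_nonneg (n : ℕ) (x : M) : 0 ≤ maxBirkhoffSum T f n x := by
  cases n with
  | zero => exact le_rfl
  | succ n => exact le_max_left _ _

lemma birkhoffSum_le_maxBirkhoffSum (n : ℕ) (x : M) :
    birkhoffSum T f n x ≤ maxBirkhoffSum T f n x := by
  induction n generalizing x with
  | zero => simp [maxBirkhoffSum]
  | succ n ih =>
    rw [birkhoffSum_succ']
    exact le_max_of_le_right (by gcongr; exact ih _)

lemma maxBirkhoffSum_le_succ (n : ℕ) (x : M) :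
    maxBirkhoffSum T f n x ≤ maxBirkhoffSum T f (n + 1) x := by
  induction n generalizing x with
  | zero => exact maxBirkhoffSum_nonneg 1 x
  | succ n ih =>
    simp only [maxBirkhoffSum]
    gcongr
    exact ih _

lemma monotone_maxBirkhoffSum (x : M) : Monotone fun n => maxBirkhoffSum T f n x :=
  monotone_nat_of_le_succ fun n => maxBirkhoffSum_le_succ n x

lemma bddAbove_range_maxBirkhoffSum_comp (x : M) :
    BddAbove (Set.range fun n => maxBirkhoffSum T f n (T x)) ↔
      BddAbove (Set.range fun n => maxBirkhoffSum T f n x) := by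
  constructor
  · rintro ⟨B, hB⟩
    refine ⟨max 0 (f x + B), ?_⟩
    rintro _ ⟨n, rfl⟩
    refine (maxBirkhoffSum_le_succ n x).trans ?_
    simp only [maxBirkhoffSum]
    gcongr
    exact hB ⟨n, rfl⟩
  · rintro ⟨B, hB⟩
    refine ⟨B - f x, ?_⟩
    rintro _ ⟨n, rfl⟩
    have h1 : maxBirkhoffSum T f (n + 1) x ≤ B := hB ⟨n + 1, rfl⟩
    have h2 : f x + maxBirkhoffSum T f n (T x) ≤ maxBirkhoffSum T f (n + 1) x := le_max_right _ _
    linarith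

variable [MeasurableSpace M] {μ : Measure M}

lemma measurable_maxBirkhoffSum (hT : Measurable T) (hf : Measurable f) (n : ℕ) :
    Measurable (maxBirkhoffSum T f n) := by
  induction n with
  | zero => exact measurable_const
  | succ n ih => exact measurable_const.max (hf.add (ih.comp hT))

lemma integrable_maxBirkhoffSum (hT : MeasurePreserving T μ μ) (hf : Integrable f μ) (n : ℕ) :
    Integrable (maxBirkhoffSum T f n) μ := by
  induction n with
  | zero => exact integrable_zero _ _ _
  | succ n ih =>
    exact (integrable_zero _ _ _).sup (hf.add (hT.integrable_comp_of_integrable ih))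

/-- If the running maxima of the Birkhoff sums were unbounded, then `max_{k ≤ n + 1} S_k f -
(max_{k ≤ n} S_k f) ∘ T`, whose integral is nonnegative by invariance of `μ`, would decrease to
`f`, against `∫ f < 0`. Ergodicity makes unboundedness an event of measure zero or one. -/
lemma ae_bddAbove_maxBirkhoffSum (hT : Ergodic T μ) (hfm : Measurable f)
    (hf : Integrable f μ) (hneg : ∫ x, f x ∂μ < 0) :
    ∀ᵐ x ∂μ, BddAbove (Set.range fun n => maxBirkhoffSum T f n x) := by
  have hTm := hT.toMeasurePreserving
  have hA : MeasurableSet {x | BddAbove (Set.range fun n => maxBirkhoffSum T f n x)} :=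
    measurableSet_bddAbove_range fun n => measurable_maxBirkhoffSum hTm.measurable hfm n
  rcases hT.toPreErgodic.ae_mem_or_ae_notMem hA
    (Set.ext fun x => bddAbove_range_maxBirkhoffSum_comp x) with h | h
  · exact h
  exfalso
  have hlim : Tendsto (fun n => ∫ x, max (-maxBirkhoffSum T f n (T x)) (f x) ∂μ) atTop
      (𝓝 (∫ x, f x ∂μ)) := by
    refine tendsto_integral_of_dominated_convergence (fun x => |f x|) (fun n => ?_) hf.abs
      (fun n => ?_) ?_
    · exact (((measurable_maxBirkhoffSum hTm.measurable hfm n).comp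
        hTm.measurable).neg.max hfm).aestronglyMeasurable
    · refine Eventually.of_forall fun x => ?_
      have := maxBirkhoffSum_nonneg (T := T) (f := f) n (T x)
      rw [Real.norm_eq_abs, abs_le]
      constructor
      · exact (neg_abs_le _).trans (le_max_right _ _)
      · exact max_le (by linarith [abs_nonneg (f x)]) (le_abs_self _)
    · filter_upwards [h] with x hx
      have hx' : ¬ BddAbove (Set.range fun n => maxBirkhoffSum T f n (T x)) := fun hb =>
        hx ((bddAbove_range_maxBirkhoffSum_comp x).1 hb)
      have ht := tendsto_atTop_atTop_of_monotone' (monotone_maxBirkhoffSum (T x)) hx'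
      refine tendsto_const_nhds.congr' ?_
      filter_upwards [ht.eventually_ge_atTop (-f x)] with n hn
      rw [max_eq_right]
      linarith
  refine hneg.not_ge (ge_of_tendsto' hlim fun n => ?_)
  have h1 : ∫ x, maxBirkhoffSum T f n (T x) ∂μ = ∫ x, maxBirkhoffSum T f n x ∂μ :=
    (integral_map hTm.aemeasurable
      (measurable_maxBirkhoffSum hTm.measurable hfm n).aestronglyMeasurable).symm.trans
      (by rw [hTm.map_eq])
  have hi := integrable_maxBirkhoffSum hTm hf n
  have hi' : Integrable (fun x => maxBirkhoffSum T f n (T x)) μ :=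
    hTm.integrable_comp_of_integrable hi
  have h2 : ∀ x, max (-maxBirkhoffSum T f n (T x)) (f x)
      = maxBirkhoffSum T f (n + 1) x - maxBirkhoffSum T f n (T x) := by
    intro x
    simp only [maxBirkhoffSum]
    rw [← max_sub_sub_right]
    simp
  simp_rw [h2]
  rw [integral_sub (integrable_maxBirkhoffSum hTm hf (n + 1)) hi', h1, sub_nonneg]
  exact integral_mono hi (integrable_maxBirkhoffSum hTm hf (n + 1))
    fun x => maxBirkhoffSum_le_succ n x

lemma ae_forall_eventually_birkhoffAverage_lt [IsProbabilityMeasure μ] (hT : Ergodic T μ)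
    (hfm : Measurable f) (hf : Integrable f μ) :
    ∀ᵐ x ∂μ, ∀ a > ∫ y, f y ∂μ, ∀ᶠ n in atTop, birkhoffAverage ℝ T f n x < a := by
  have key : ∀ j : ℕ, ∀ᵐ x ∂μ, BddAbove (Set.range fun n =>
      maxBirkhoffSum T (fun y => f y - (∫ z, f z ∂μ + 1 / ((j : ℝ) + 1))) n x) := by
    intro j
    refine ae_bddAbove_maxBirkhoffSum hT (hfm.sub_const _) (hf.sub (integrable_const _)) ?_
    rw [integral_sub hf (integrable_const _)]
    simp only [integral_const, probReal_univ, one_smul]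
    linarith [Nat.one_div_pos_of_nat (α := ℝ) (n := j)]
  filter_upwards [ae_all_iff.2 key] with x hx a ha
  obtain ⟨j, hj⟩ := exists_nat_one_div_lt (sub_pos.2 ha)
  obtain ⟨B, hB⟩ := hx j
  set b := ∫ z, f z ∂μ + 1 / ((j : ℝ) + 1) with hb
  have hba : b < a := by linarith
  have hlim : Tendsto (fun n : ℕ => b + B / (n : ℝ)) atTop (𝓝 (b + 0)) :=
    tendsto_const_nhds.add (tendsto_const_div_atTop_nhds_zero_nat B)
  rw [add_zero] at hlim
  filter_upwards [hlim.eventually_lt_const hba, eventually_gt_atTop 0] with n hn hn0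
  have h1 : birkhoffSum T (fun y => f y - b) n x ≤ B :=
    (birkhoffSum_le_maxBirkhoffSum n x).trans (hB ⟨n, rfl⟩)
  have h2 : birkhoffSum T (fun y => f y - b) n x = birkhoffSum T f n x - n * b := by
    simp [birkhoffSum]
  have hn0' : (0 : ℝ) < n := by exact_mod_cast hn0
  refine lt_of_le_of_lt ?_ hn
  rw [birkhoffAverage, smul_eq_mul, inv_mul_le_iff₀ hn0', mul_add, mul_div_cancel₀ _ hn0'.ne']
  linarith

/-- **Birkhoff's pointwise ergodic theorem** for an ergodic transformation. -/
theorem ae_tendsto_birkhoffAverage [IsProbabilityMeasure μ] (hT : Ergodic T μ)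
    (hf : Integrable f μ) :
    ∀ᵐ x ∂μ, Tendsto (fun n => birkhoffAverage ℝ T f n x) atTop (𝓝 (∫ y, f y ∂μ)) := by
  obtain ⟨g, hgm, hfg⟩ := hf.1.aemeasurable
  have hg : Integrable g μ := hf.congr hfg
  have horbit : ∀ᵐ x ∂μ, ∀ k : ℕ, f (T^[k] x) = g (T^[k] x) :=
    ae_all_iff.2 fun k =>
      (hT.toMeasurePreserving.iterate k).quasiMeasurePreserving.ae hfg
  filter_upwards [horbit, ae_forall_eventually_birkhoffAverage_lt hT hgm hg,
    ae_forall_eventually_birkhoffAverage_lt hT hgm.neg hg.neg] with x hx hup hlow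
  have heq : ∀ n, birkhoffAverage ℝ T f n x = birkhoffAverage ℝ T g n x := by
    intro n
    simp only [birkhoffAverage, birkhoffSum, hx]
  simp_rw [heq, integral_congr_ae hfg]
  refine tendsto_order.2 ⟨fun a ha => ?_, fun a ha => hup a ha⟩
  have h := hlow (-a) (by
    simp only [Pi.neg_apply, integral_neg]
    linarith)
  filter_upwards [h] with n hn
  have : birkhoffAverage ℝ T (-g) n x = -birkhoffAverage ℝ T g n x := by
    simp [birkhoffAverage, birkhoffSum, Finset.sum_neg_distrib]
  linarith

end Birkhoff

namespace MoranSet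

/-! ### Dimensions from the masses of balls -/

section Cover

variable {X : Type*} [MetricSpace X]

lemma exists_finset_isSeparated_isCover {A : Set X} (hA : TotallyBounded A) {r : ℝ≥0}
    (hr : r ≠ 0) :
    ∃ P : Finset X, (P : Set X) ⊆ A ∧ Metric.IsSeparated r (P : Set X) ∧
      Metric.IsCover r A (P : Set X) ∧ (P.card : ℕ∞) = Metric.packingNumber r A := by
  have hfin : Metric.packingNumber r A ≠ ⊤ := by
    obtain ⟨N, -, hN, hc⟩ := Metric.exists_finite_isCover_of_totallyBounded
      (ε := r / 2) (by positivity) hA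
    have h := Metric.packingNumber_two_mul_le_externalCoveringNumber (r / 2) A
    rw [mul_div_cancel₀ r two_ne_zero] at h
    exact ne_top_of_le_ne_top (Set.encard_ne_top_iff.2 hN)
      (h.trans hc.externalCoveringNumber_le_encard)
  have henc := Metric.encard_maximalSeparatedSet hfin
  have hf : (Metric.maximalSeparatedSet r A).Finite :=
    Set.encard_ne_top_iff.1 (by rw [henc]; exact hfin)
  refine ⟨hf.toFinset, ?_, ?_, ?_, ?_⟩
  · simpa using Metric.maximalSeparatedSet_subset
  · simpa using Metric.isSeparated_maximalSeparatedSet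
  · simpa using Metric.isCover_maximalSeparatedSet hfin
  · rw [← henc, hf.encard_eq_coe_toFinset_card]

lemma pairwiseDisjoint_closedBall_of_isSeparated {P : Set X} {r : ℝ≥0}
    (hP : Metric.IsSeparated ((2 * r : ℝ≥0) : ℝ≥0∞) P) :
    P.PairwiseDisjoint fun x => Metric.closedBall x (r : ℝ) := by
  intro x hx y hy hxy
  refine Metric.closedBall_disjoint_closedBall ?_
  have h : ((2 * r : ℝ≥0) : ℝ≥0∞) < edist x y := hP hx hy hxy
  rw [edist_nndist, ENNReal.coe_lt_coe] at h
  have h' : ((2 * r : ℝ≥0) : ℝ) < dist x y := by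
    rw [← coe_nndist]; exact_mod_cast h
  push_cast at h'
  linarith

lemma subset_iUnion_closedBall_of_isCover {A : Set X} {P : Finset X} {r : ℝ≥0}
    (h : Metric.IsCover r A (P : Set X)) : A ⊆ ⋃ x ∈ P, Metric.closedBall x (r : ℝ) := by
  intro y hy
  obtain ⟨x, hx, hxy⟩ := h hy
  refine Set.mem_iUnion₂.2 ⟨x, hx, ?_⟩
  have : edist y x ≤ r := hxy
  rw [edist_nndist, ENNReal.coe_le_coe] at this
  rw [Metric.mem_closedBall, ← coe_nndist]
  exact_mod_cast this

lemma log_ofReal_mul_rpow_neg {c t : ℝ} (hc : 0 < c) {ε : ℝ} (hε : 0 < ε) (hε1 : ε < 1) :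
    ENNReal.log (ENNReal.ofReal (c * ε ^ (-t))) / ((Real.log (1 / ε) : ℝ) : EReal)
      = ((Real.log c / Real.log (1 / ε) + t : ℝ) : EReal) := by
  have hlog : 0 < Real.log (1 / ε) := Real.log_pos (one_lt_one_div hε hε1)
  rw [ENNReal.log_ofReal_of_pos (by positivity), ← EReal.coe_div, Real.log_mul hc.ne'
    (by positivity), Real.log_rpow hε, add_div]
  congr 2
  rw [div_eq_iff hlog.ne', one_div, Real.log_inv]
  ring

lemma tendsto_div_log_one_div_add (c t : ℝ) :
    Tendsto (fun ε : ℝ≥0 => ((Real.log c / Real.log (1 / (ε : ℝ)) + t : ℝ) : EReal)) (𝓝[>] 0)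
      (𝓝 (t : EReal)) := by
  refine (continuous_coe_real_ereal.tendsto t).comp ?_
  have h1 : Tendsto (fun ε : ℝ≥0 => (ε : ℝ)) (𝓝[>] 0) (𝓝[>] 0) := by
    refine tendsto_nhdsWithin_iff.2 ⟨?_, ?_⟩
    · exact (NNReal.continuous_coe.tendsto' 0 0 rfl).mono_left nhdsWithin_le_nhds
    · filter_upwards [self_mem_nhdsWithin] with ε hε
      exact hε
  have h2 : Tendsto (fun ε : ℝ≥0 => Real.log (1 / (ε : ℝ))) (𝓝[>] 0) atTop := by
    simp_rw [one_div]
    exact Real.tendsto_log_atTop.comp (tendsto_inv_nhdsGT_zero.comp h1)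
  simpa using (h2.const_div_atTop (Real.log c)).add_const t

lemma upperBoxDim_le_of_eventually_le {A : Set X} {c t : ℝ} (hc : 0 < c)
    (h : ∀ᶠ ε : ℝ≥0 in 𝓝[>] 0,
      ((Metric.externalCoveringNumber ε A : ℕ∞) : ℝ≥0∞) ≤ ENNReal.ofReal (c * (ε : ℝ) ^ (-t))) :
    upperBoxDim A ≤ (t : EReal) := by
  rw [← (tendsto_div_log_one_div_add c t).limsup_eq]
  refine limsup_le_limsup ?_
  filter_upwards [h, Ioo_mem_nhdsGT one_pos] with ε hε hε1
  rw [← log_ofReal_mul_rpow_neg (ε := (ε : ℝ)) hc hε1.1 hε1.2]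
  refine EReal.div_le_div_right_of_nonneg ?_ (ENNReal.log_le_log hε)
  exact_mod_cast (Real.log_pos (one_lt_one_div (NNReal.coe_pos.2 hε1.1) hε1.2)).le

lemma le_upperBoxDim_of_eventually_le {A : Set X} {c s : ℝ} (hc : 0 < c)
    (h : ∀ᶠ ε : ℝ≥0 in 𝓝[>] 0,
      ENNReal.ofReal (c * (ε : ℝ) ^ (-s)) ≤ ((Metric.externalCoveringNumber ε A : ℕ∞) : ℝ≥0∞)) :
    (s : EReal) ≤ upperBoxDim A := by
  rw [← (tendsto_div_log_one_div_add c s).limsup_eq]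
  refine limsup_le_limsup ?_
  filter_upwards [h, Ioo_mem_nhdsGT one_pos] with ε hε hε1
  rw [← log_ofReal_mul_rpow_neg (ε := (ε : ℝ)) hc hε1.1 hε1.2]
  refine EReal.div_le_div_right_of_nonneg ?_ (ENNReal.log_le_log hε)
  exact_mod_cast (Real.log_pos (one_lt_one_div (NNReal.coe_pos.2 hε1.1) hε1.2)).le

lemma prePackingScale_empty (s ε : ℝ) : prePackingScale s ε (∅ : Set X) = 0 := by
  refine le_antisymm (iSup₂_le fun P hP => ?_) bot_le
  have : P = ∅ := Finset.eq_empty_of_forall_notMem fun p hp => (hP.1 p hp).1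
  simp [this]

lemma packingMeasure_le_prePackingScale {s ε : ℝ} (hε : 0 < ε) (A : Set X) :
    packingMeasure s A ≤ prePackingScale s ε A := by
  refine (iInf₂_le (fun i : ℕ => if i = 0 then A else ∅)
    (fun x hx => Set.mem_iUnion.2 ⟨0, by simpa using hx⟩)).trans ?_
  rw [tsum_eq_single 0]
  · exact iInf₂_le ε hε
  · intro i hi
    simp only [hi, if_false]
    refine le_antisymm ((iInf₂_le 1 one_pos).trans ?_) bot_le
    rw [prePackingScale_empty]

end Cover

section LowerMass

variable {X : Type*} [MetricSpace X] [MeasurableSpace X] [BorelSpace X] {F : Set X}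
  {m : Measure X} [IsFiniteMeasure m] {t K r₀ : ℝ}

lemma card_mul_rpow_le_of_lowerMass
    (h : ∀ x ∈ F, ∀ r, 0 < r → r ≤ r₀ → r ^ t ≤ K * m.real (Metric.closedBall x r))
    (hK : 0 ≤ K) {P : Finset X} (hPF : (P : Set X) ⊆ F) {r : ℝ≥0} (hr : 0 < r) (hr' : r ≤ r₀)
    (hP : Metric.IsSeparated ((2 * r : ℝ≥0) : ℝ≥0∞) (P : Set X)) :
    P.card * (r : ℝ) ^ t ≤ K * m.real Set.univ := by
  calc P.card * (r : ℝ) ^ t = ∑ x ∈ P, (r : ℝ) ^ t := by simp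
    _ ≤ ∑ x ∈ P, K * m.real (Metric.closedBall x r) :=
        Finset.sum_le_sum fun x hx => h x (hPF hx) r hr hr'
    _ = K * m.real (⋃ x ∈ P, Metric.closedBall x (r : ℝ)) := by
        rw [← Finset.mul_sum, measureReal_biUnion_finset
          (pairwiseDisjoint_closedBall_of_isSeparated hP)
          (fun x _ => Metric.isClosed_closedBall.measurableSet)]
    _ ≤ K * m.real Set.univ := by gcongr; exacts [measure_ne_top _ _, Set.subset_univ _]

lemma exists_cover_card_mul_rpow_le (hF : TotallyBounded F) (hK : 0 ≤ K)
    (h : ∀ x ∈ F, ∀ r, 0 < r → r ≤ r₀ → r ^ t ≤ K * m.real (Metric.closedBall x r))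
    {r : ℝ≥0} (hr : 0 < r) (hr' : r ≤ r₀) :
    ∃ P : Finset X, Metric.IsCover r F (P : Set X) ∧
      P.card * (r : ℝ) ^ t ≤ 2 ^ t * (K * m.real Set.univ) := by
  obtain ⟨P, hPF, hsep, hcov, -⟩ := exists_finset_isSeparated_isCover hF hr.ne'
  refine ⟨P, hcov, ?_⟩
  have hr2 : (0 : ℝ) < r := hr
  have := card_mul_rpow_le_of_lowerMass h hK hPF (r := r / 2) (by positivity)
    (by push_cast; linarith) (by rwa [mul_div_cancel₀ r two_ne_zero])
  calc P.card * (r : ℝ) ^ t = 2 ^ t * (P.card * ((r / 2 : ℝ≥0) : ℝ) ^ t) := by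
        push_cast
        rw [Real.div_rpow hr2.le zero_le_two]
        field_simp
    _ ≤ _ := by gcongr

lemma dimH_le_of_lowerMass (hF : TotallyBounded F) (hK : 0 ≤ K) (ht : 0 ≤ t) (hr₀ : 0 < r₀)
    (h : ∀ x ∈ F, ∀ r, 0 < r → r ≤ r₀ → r ^ t ≤ K * m.real (Metric.closedBall x r)) :
    dimH F ≤ ENNReal.ofReal t := by
  obtain ⟨u, -, hu0, hu⟩ := exists_seq_strictAnti_tendsto' (Real.toNNReal_pos.2 hr₀)
  have hcov : ∀ n, ∃ P : Finset X, Metric.IsCover (u n) F (P : Set X) ∧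
      P.card * (u n : ℝ) ^ t ≤ 2 ^ t * (K * m.real Set.univ) := fun n =>
    exists_cover_card_mul_rpow_le hF hK h (hu0 n).1
      ((NNReal.coe_le_coe.2 (hu0 n).2.le).trans_eq (Real.coe_toNNReal _ hr₀.le))
  choose P hP hcard using hcov
  refine dimH_le_of_hausdorffMeasure_ne_top (d := t.toNNReal) ?_
  rw [Real.coe_toNNReal _ ht]
  refine ne_top_of_le_ne_top (b := ENNReal.ofReal (2 ^ t * (2 ^ t * (K * m.real Set.univ))))
    ENNReal.ofReal_ne_top ?_
  have hr : Tendsto (fun n => 2 * (u n : ℝ≥0∞)) atTop (𝓝 0) := by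
    have := ENNReal.Tendsto.const_mul (a := 2) (ENNReal.tendsto_coe.2 hu)
      (Or.inr ENNReal.ofNat_ne_top)
    simpa using this
  have hdiam : ∀ n (x : X), Metric.ediam (Metric.closedBall x (u n : ℝ)) ≤ 2 * (u n : ℝ≥0∞) := by
    intro n x
    rw [← Metric.closedEBall_coe]
    exact Metric.ediam_closedEBall_le
  refine (Measure.hausdorffMeasure_le_liminf_sum t F _ hr
    (fun n (x : P n) => Metric.closedBall (x : X) (u n : ℝ))
    (Eventually.of_forall fun n x => hdiam n x) (Eventually.of_forall fun n => ?_)).trans ?_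
  · have := subset_iUnion_closedBall_of_isCover (hP n)
    rwa [← Set.iUnion_subtype (fun x => x ∈ P n)
      (fun x : P n => Metric.closedBall (x : X) (u n : ℝ))] at this
  · refine (liminf_le_liminf (v := fun _ => ENNReal.ofReal (2 ^ t * (2 ^ t * (K * m.real Set.univ))))
      (Eventually.of_forall fun n => ?_)).trans_eq (by simp)
    have hun : (0 : ℝ) < u n := (hu0 n).1
    calc ∑ x : P n, Metric.ediam (Metric.closedBall (x : X) (u n : ℝ)) ^ t
        ≤ ∑ x : P n, (2 * (u n : ℝ≥0∞)) ^ t :=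
          Finset.sum_le_sum fun x _ => ENNReal.rpow_le_rpow (hdiam n x) ht
      _ = ENNReal.ofReal (2 ^ t * ((P n).card * (u n : ℝ) ^ t)) := by
          rw [Finset.sum_const, Finset.card_univ, Fintype.card_coe, nsmul_eq_mul,
            ENNReal.mul_rpow_of_nonneg _ _ ht, ENNReal.ofReal_mul (by positivity),
            ENNReal.ofReal_mul (by positivity), ← ENNReal.ofReal_rpow_of_pos zero_lt_two,
            ← ENNReal.ofReal_rpow_of_pos hun, ENNReal.ofReal_natCast, ENNReal.ofReal_coe_nnreal]
          simp only [ENNReal.ofReal_ofNat]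
          ring
      _ ≤ _ := ENNReal.ofReal_le_ofReal (mul_le_mul_of_nonneg_left (hcard n) (by positivity))

lemma upperBoxDim_le_of_lowerMass (hF : TotallyBounded F) (hK : 0 ≤ K) (hr₀ : 0 < r₀)
    (h : ∀ x ∈ F, ∀ r, 0 < r → r ≤ r₀ → r ^ t ≤ K * m.real (Metric.closedBall x r)) :
    upperBoxDim F ≤ (t : EReal) := by
  have hB : 0 < 2 ^ t * (K * m.real Set.univ) + 1 := by positivity
  refine upperBoxDim_le_of_eventually_le hB ?_
  filter_upwards [Ioo_mem_nhdsGT (Real.toNNReal_pos.2 hr₀)] with r hr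
  obtain ⟨P, hP, hcard⟩ := exists_cover_card_mul_rpow_le hF hK h hr.1
      ((NNReal.coe_le_coe.2 hr.2.le).trans_eq (Real.coe_toNNReal _ hr₀.le))
  have hr1 : (0 : ℝ) < r := hr.1
  have h1 : Metric.externalCoveringNumber r F ≤ (P.card : ℕ∞) := by
    simpa using hP.externalCoveringNumber_le_encard
  calc ((Metric.externalCoveringNumber r F : ℕ∞) : ℝ≥0∞) ≤ ((P.card : ℕ∞) : ℝ≥0∞) := by
        exact_mod_cast h1
    _ = ENNReal.ofReal P.card := by simp
    _ ≤ _ := by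
        refine ENNReal.ofReal_le_ofReal ?_
        rw [Real.rpow_neg hr1.le, ← div_eq_mul_inv, le_div_iff₀ (by positivity)]
        linarith

lemma packingDim_le_of_lowerMass (hK : 0 ≤ K) (ht : 0 ≤ t) (hr₀ : 0 < r₀)
    (h : ∀ x ∈ F, ∀ r, 0 < r → r ≤ r₀ → r ^ t ≤ K * m.real (Metric.closedBall x r)) :
    packingDim F ≤ ENNReal.ofReal t := by
  refine iSup₂_le fun s hs => ?_
  by_contra! hlt
  have hts : t < s := by
    rw [← ENNReal.ofReal_coe_nnreal] at hlt
    exact (ENNReal.ofReal_lt_ofReal_iff_of_nonneg ht).1 hlt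
  have hε : 0 < min r₀ 1 := lt_min hr₀ one_pos
  refine (lt_top_iff_ne_top.1 ?_) hs
  refine (packingMeasure_le_prePackingScale hε F).trans_lt
    (lt_of_le_of_lt (b := ENNReal.ofReal (2 ^ (s : ℝ) * (K * m.real Set.univ))) ?_
      ENNReal.ofReal_lt_top)
  refine iSup₂_le fun P hP => ?_
  calc ∑ p ∈ P, Metric.ediam (Metric.closedBall p.1 p.2) ^ (s : ℝ)
      ≤ ∑ p ∈ P, ENNReal.ofReal (2 ^ (s : ℝ) * (K * m.real (Metric.closedBall p.1 p.2))) := by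
        refine Finset.sum_le_sum fun p hp => ?_
        obtain ⟨hpF, hp0, hpε⟩ := hP.1 p hp
        have h1 : Metric.ediam (Metric.closedBall p.1 p.2) ≤ ENNReal.ofReal (2 * p.2) := by
          rw [← Metric.closedEBall_ofReal hp0.le, ENNReal.ofReal_mul zero_le_two,
            ENNReal.ofReal_ofNat]
          exact Metric.ediam_closedEBall_le
        refine (ENNReal.rpow_le_rpow h1 s.2).trans ?_
        rw [ENNReal.ofReal_rpow_of_pos (by positivity)]
        refine ENNReal.ofReal_le_ofReal ?_
        rw [Real.mul_rpow zero_le_two hp0.le]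
        refine mul_le_mul_of_nonneg_left ?_ (by positivity)
        exact (Real.rpow_le_rpow_of_exponent_ge hp0 (hpε.trans (min_le_right _ _)) hts.le).trans
          (h _ hpF _ hp0 (hpε.trans (min_le_left _ _)))
    _ = ENNReal.ofReal (2 ^ (s : ℝ) * (K * m.real (⋃ p ∈ P, Metric.closedBall p.1 p.2))) := by
        rw [← ENNReal.ofReal_sum_of_nonneg (fun p _ => by positivity), ← Finset.mul_sum,
          ← Finset.mul_sum, measureReal_biUnion_finset hP.2
            (fun p _ => Metric.isClosed_closedBall.measurableSet)]
    _ ≤ _ := by gcongr; exacts [measure_ne_top _ _, Set.subset_univ _]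

end LowerMass

section UpperMass

variable {X : Type*} [MetricSpace X] [MeasurableSpace X] {F : Set X}
  {m : Measure X} [IsFiniteMeasure m] {s K r₀ : ℝ}

lemma measureReal_le_card_mul_rpow
    (h : ∀ x ∈ F, ∀ r, 0 ≤ r → r ≤ r₀ → m.real (Metric.closedBall x r) ≤ K * r ^ s)
    {A : Set X} {P : Finset X} (hPF : (P : Set X) ⊆ F) {r : ℝ≥0} (hr' : r ≤ r₀)
    (hP : Metric.IsCover r A (P : Set X)) :
    m.real A ≤ P.card * (K * (r : ℝ) ^ s) := by
  calc m.real A ≤ m.real (⋃ x ∈ P, Metric.closedBall x (r : ℝ)) :=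
        measureReal_mono (subset_iUnion_closedBall_of_isCover hP) (measure_ne_top _ _)
    _ ≤ ∑ x ∈ P, m.real (Metric.closedBall x (r : ℝ)) := measureReal_biUnion_finset_le _ _
    _ ≤ ∑ x ∈ P, K * (r : ℝ) ^ s := Finset.sum_le_sum fun x hx => h x (hPF hx) r r.2 hr'
    _ = _ := by simp

lemma le_upperBoxDim_of_upperMass (hF : TotallyBounded F) (hK : 0 < K) (hr₀ : 0 < r₀)
    (hm : 0 < m.real F)
    (h : ∀ x ∈ F, ∀ r, 0 ≤ r → r ≤ r₀ → m.real (Metric.closedBall x r) ≤ K * r ^ s) :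
    (s : EReal) ≤ upperBoxDim F := by
  have hc : 0 < m.real F / (K * 2 ^ s) := by positivity
  refine le_upperBoxDim_of_eventually_le hc ?_
  filter_upwards [Ioo_mem_nhdsGT (Real.toNNReal_pos.2 (half_pos hr₀))] with r hr
  have hr1 : (0 : ℝ) < r := hr.1
  have hr2 : (r : ℝ) < r₀ / 2 :=
    (NNReal.coe_lt_coe.2 hr.2).trans_eq (Real.coe_toNNReal _ (half_pos hr₀).le)
  obtain ⟨P, hPF, -, hcov, hcard⟩ :=
    exists_finset_isSeparated_isCover hF (r := 2 * r) (mul_ne_zero two_ne_zero hr.1.ne')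
  have h1 := measureReal_le_card_mul_rpow h hPF (by push_cast; linarith) hcov
  have h2 : (P.card : ℕ∞) ≤ Metric.externalCoveringNumber r F :=
    hcard.trans_le (Metric.packingNumber_two_mul_le_externalCoveringNumber r F)
  calc ENNReal.ofReal (m.real F / (K * 2 ^ s) * (r : ℝ) ^ (-s)) ≤ ENNReal.ofReal P.card := by
        refine ENNReal.ofReal_le_ofReal ?_
        rw [Real.rpow_neg hr1.le, ← div_eq_mul_inv, div_div, div_le_iff₀ (by positivity)]
        push_cast at h1
        rw [Real.mul_rpow zero_le_two hr1.le] at h1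
        linarith
    _ = ((P.card : ℕ∞) : ℝ≥0∞) := by simp
    _ ≤ _ := by exact_mod_cast h2

/-- The mass distribution principle for the Hausdorff dimension. -/
lemma le_dimH_of_upperMass [BorelSpace X] (hs : 0 < s) (hr₀ : 0 < r₀)
    (hm : 0 < m.real F) (hmF : m Fᶜ = 0)
    (h : ∀ x ∈ F, ∀ r, 0 ≤ r → r ≤ r₀ → m.real (Metric.closedBall x r) ≤ K * r ^ s) :
    ENNReal.ofReal s ≤ dimH F := by
  refine le_dimH_of_hausdorffMeasure_ne_zero (d := s.toNNReal) ?_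
  rw [Real.coe_toNNReal _ hs.le]
  have hle : (ENNReal.ofReal K)⁻¹ • m ≤ μH[s] := by
    refine Measure.le_hausdorffMeasure s _ (ENNReal.ofReal r₀) (ENNReal.ofReal_pos.2 hr₀) ?_
    intro U hU
    have hfin : Metric.ediam U ≠ ∞ := ne_top_of_le_ne_top ENNReal.ofReal_ne_top hU
    rw [Measure.smul_apply, smul_eq_mul, mul_comm, ← div_eq_mul_inv]
    refine ENNReal.div_le_of_le_mul ?_
    by_cases hUF : (U ∩ F).Nonempty
    · obtain ⟨x, hxU, hxF⟩ := hUF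
      have hd : Metric.diam U ≤ r₀ := ENNReal.toReal_le_of_le_ofReal hr₀.le hU
      calc m U = ENNReal.ofReal (m.real U) := (ofReal_measureReal).symm
        _ ≤ ENNReal.ofReal (K * Metric.diam U ^ s) := by
            refine ENNReal.ofReal_le_ofReal ((measureReal_mono fun y hy => ?_).trans
              (h x hxF _ Metric.diam_nonneg hd))
            exact Metric.dist_le_diam_of_mem' hfin hy hxU
        _ = Metric.ediam U ^ s * ENNReal.ofReal K := by
            rw [mul_comm, ENNReal.ofReal_mul (by positivity),
              ← ENNReal.ofReal_rpow_of_nonneg Metric.diam_nonneg hs.le, Metric.diam,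
              ENNReal.ofReal_toReal hfin]
    · have : m U = 0 := measure_mono_null
        (fun y hy hyF => hUF ⟨y, hy, hyF⟩) hmF
      rw [this]
      exact bot_le
  intro h0
  have := hle F
  rw [h0, Measure.smul_apply, smul_eq_mul, nonpos_iff_eq_zero, mul_eq_zero] at this
  rcases this with h' | h'
  · simp at h'
  · simp [Measure.real, h'] at hm

end UpperMass

section PackingUpperMass

variable {E : Type*} [NormedAddCommGroup E] [NormedSpace ℝ E] [MeasurableSpace E]
  {F : Set E} {m : Measure E} [IsFiniteMeasure m] {s K r₀ : ℝ}

/-- A maximal `2δ`-separated subset of `U ∩ F` has at least `c δ ^ (-s)` points, and the balls of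
radius `δ` around them are disjoint of diameter `2δ`; so `P^{s'}_ε(U) ≥ c' δ ^ (s' - s)`, for all
small `δ`. -/
lemma prePacking_eq_top_of_upperMass [Nontrivial E] (hF : TotallyBounded F) (hK : 0 < K)
    (hr₀ : 0 < r₀)
    (h : ∀ x ∈ F, ∀ r, 0 ≤ r → r ≤ r₀ → m.real (Metric.closedBall x r) ≤ K * r ^ s)
    {U : Set E} (hU : 0 < m.real (U ∩ F)) {s' : ℝ} (hss' : s' < s) :
    prePacking s' U = ∞ := by
  refine iInf₂_eq_top.2 fun ε hε => ?_
  have hlim : Tendsto (fun δ : ℝ => ENNReal.ofReal (m.real (U ∩ F) / K * (2 * δ) ^ (s' - s)))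
      (𝓝[>] 0) (𝓝 ∞) := by
    refine ENNReal.tendsto_ofReal_nhds_top.2 ?_
    refine Tendsto.const_mul_atTop (by positivity) ?_
    have h1 : Tendsto (fun δ : ℝ => 2 * δ) (𝓝[>] 0) (𝓝[>] 0) := by
      refine tendsto_nhdsWithin_iff.2 ⟨?_, ?_⟩
      · have : Tendsto (fun δ : ℝ => 2 * δ) (𝓝 0) (𝓝 (2 * 0)) := tendsto_id.const_mul 2
        rw [mul_zero] at this
        exact this.mono_left nhdsWithin_le_nhds
      · filter_upwards [self_mem_nhdsWithin] with δ hδ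
        exact mul_pos two_pos (Set.mem_Ioi.1 hδ)
    exact (tendsto_rpow_neg_nhdsGT_zero (by linarith)).comp h1
  refine top_le_iff.1 (le_of_tendsto hlim ?_)
  filter_upwards [Ioo_mem_nhdsGT (lt_min hε (half_pos hr₀))] with δ hδ
  obtain ⟨hδ0, hδ1⟩ := hδ
  rw [lt_min_iff] at hδ1
  lift δ to ℝ≥0 using hδ0.le
  obtain ⟨P, hPF, hsep, hcov, -⟩ := exists_finset_isSeparated_isCover
    (hF.subset (Set.inter_subset_right (s := U))) (r := 2 * δ)
    (mul_ne_zero two_ne_zero (NNReal.coe_pos.1 hδ0).ne')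
  have h1 := measureReal_le_card_mul_rpow h (hPF.trans Set.inter_subset_right)
    (by push_cast; linarith) hcov
  have hinj : Function.Injective fun x : E => (x, (δ : ℝ)) := fun x y hxy => congrArg Prod.fst hxy
  let Q : Finset (E × ℝ) := P.map ⟨_, hinj⟩
  have hQ : (∀ p ∈ Q, p.1 ∈ U ∧ 0 < p.2 ∧ p.2 ≤ ε) ∧
      (Q : Set (E × ℝ)).PairwiseDisjoint (fun p => Metric.closedBall p.1 p.2) := by
    constructor
    · intro p hp
      obtain ⟨x, hx, rfl⟩ := Finset.mem_map.1 hp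
      exact ⟨(hPF hx).1, hδ0, hδ1.1.le⟩
    · rw [Finset.coe_map]
      exact (Set.InjOn.pairwiseDisjoint_image hinj.injOn).2
        (pairwiseDisjoint_closedBall_of_isSeparated hsep)
  refine le_trans ?_ (le_iSup₂ (f := fun (P : Finset (E × ℝ)) (_ : (∀ p ∈ P, p.1 ∈ U ∧ 0 < p.2 ∧
    p.2 ≤ ε) ∧ (P : Set (E × ℝ)).PairwiseDisjoint (fun p => Metric.closedBall p.1 p.2)) =>
    ∑ p ∈ P, Metric.ediam (Metric.closedBall p.1 p.2) ^ s') Q hQ)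
  have hdiam : ∀ x : E, Metric.ediam (Metric.closedBall x (δ : ℝ)) = ENNReal.ofReal (2 * δ) := by
    intro x
    rw [← Metric.diam_closedBall_eq x hδ0.le, Metric.diam,
      ENNReal.ofReal_toReal Metric.isBounded_closedBall.ediam_ne_top]
  simp only [Q, Finset.sum_map, Function.Embedding.coeFn_mk, hdiam]
  rw [Finset.sum_const, nsmul_eq_mul, ENNReal.ofReal_rpow_of_pos (by positivity),
    ← ENNReal.ofReal_natCast, ← ENNReal.ofReal_mul (by positivity)]
  refine ENNReal.ofReal_le_ofReal ?_
  push_cast at h1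
  rw [Real.rpow_sub (by positivity), div_mul_div_comm, div_le_iff₀ (by positivity)]
  calc m.real (U ∩ F) * (2 * (δ : ℝ)) ^ s'
      ≤ (P.card * (K * (2 * (δ : ℝ)) ^ s)) * (2 * (δ : ℝ)) ^ s' := by gcongr
    _ = _ := by ring

lemma le_packingDim_of_upperMass (hF : TotallyBounded F) (hs : 0 < s) (hK : 0 < K)
    (hr₀ : 0 < r₀) (hm : 0 < m.real F)
    (h : ∀ x ∈ F, ∀ r, 0 ≤ r → r ≤ r₀ → m.real (Metric.closedBall x r) ≤ K * r ^ s) :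
    ENNReal.ofReal s ≤ packingDim F := by
  rcases subsingleton_or_nontrivial E with hE | hE
  · -- In a one-point space `m` would be an atom at a point of `F`, which the bound excludes.
    exfalso
    have hne : F.Nonempty := by
      by_contra! hempty
      simp [hempty] at hm
    obtain ⟨x, hx⟩ := hne
    have h0 := h x hx 0 le_rfl hr₀.le
    rw [Real.zero_rpow hs.ne', mul_zero] at h0
    refine hm.not_ge ((measureReal_mono fun y _ => ?_).trans h0)
    rw [Subsingleton.elim y x]
    simp
  refine le_of_forall_lt fun a ha => ?_
  obtain ⟨b, hab, hbs⟩ := ENNReal.lt_iff_exists_nnreal_btwn.1 ha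
  refine hab.trans_le ?_
  have hbs' : (b : ℝ) < s := by
    rw [← ENNReal.ofReal_coe_nnreal] at hbs
    exact (ENNReal.ofReal_lt_ofReal_iff_of_nonneg b.2).1 hbs
  refine le_iSup₂ (f := fun (s : ℝ≥0) (_ : packingMeasure (s : ℝ) F = ∞) => (s : ℝ≥0∞)) b ?_
  refine iInf₂_eq_top.2 fun U hU => ?_
  have hi : ∃ i, m (U i ∩ F) ≠ 0 := by
    by_contra! hi
    have h0 : m (⋃ i, U i ∩ F) = 0 := measure_iUnion_null hi
    rw [← Set.iUnion_inter, Set.inter_eq_right.2 hU] at h0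
    simp [Measure.real, h0] at hm
  obtain ⟨i, hi⟩ := hi
  exact ENNReal.tsum_eq_top_of_eq_top ⟨i, prePacking_eq_top_of_upperMass hF hK hr₀ h
    (ENNReal.toReal_pos hi (measure_ne_top _ _)) hbs'⟩

/-- If a finite measure carried by `F` gives balls of radius `r` centred in `F` a mass between
`r ^ t` and `r ^ s`, up to constants, for all `s < D < t`, then all dimensions of `F` are `D`. The
constants may depend on `s` and `t`. -/
theorem dimensions_eq_of_ballMass [BorelSpace E] (hF : TotallyBounded F) (hm : 0 < m.real F) (hmF : m Fᶜ = 0)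
    {D : ℝ} (hD : 0 ≤ D)
    (hlow : ∀ t > D, ∃ K ≥ 0, ∃ r₀ > 0, ∀ x ∈ F, ∀ r, 0 < r → r ≤ r₀ →
      r ^ t ≤ K * m.real (Metric.closedBall x r))
    (hup : ∀ s, 0 < s → s < D → ∃ K > 0, ∃ r₀ > 0, ∀ x ∈ F, ∀ r, 0 ≤ r → r ≤ r₀ →
      m.real (Metric.closedBall x r) ≤ K * r ^ s) :
    ((dimH F : ℝ≥0∞) : EReal) = (D : EReal) ∧ ((packingDim F : ℝ≥0∞) : EReal) = (D : EReal) ∧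
      upperBoxDim F = (D : EReal) := by
  have hofReal : ((ENNReal.ofReal D : ℝ≥0∞) : EReal) = (D : EReal) := by
    rw [EReal.coe_ennreal_ofReal, max_eq_left hD]
  have le_of_forall_gt' : ∀ a : ℝ≥0∞, (∀ t > D, a ≤ ENNReal.ofReal t) → a ≤ ENNReal.ofReal D := by
    intro a ha
    refine ge_of_tendsto ((ENNReal.continuous_ofReal.tendsto D).mono_left
      (nhdsWithin_le_nhds (s := Set.Ioi D))) ?_
    filter_upwards [self_mem_nhdsWithin] with t ht using ha t ht
  have le_of_forall_lt' : ∀ a : ℝ≥0∞, (∀ s, 0 < s → s < D → ENNReal.ofReal s ≤ a) →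
      ENNReal.ofReal D ≤ a := by
    intro a ha
    rcases hD.eq_or_lt with rfl | hD
    · simp
    refine le_of_tendsto ((ENNReal.continuous_ofReal.tendsto D).mono_left
      (nhdsWithin_le_nhds (s := Set.Iio D))) ?_
    filter_upwards [Ioo_mem_nhdsLT hD] with s hs using ha s hs.1 hs.2
  refine ⟨?_, ?_, ?_⟩
  · rw [← hofReal, EReal.coe_ennreal_eq_coe_ennreal_iff]
    refine le_antisymm (le_of_forall_gt' _ fun t ht => ?_) (le_of_forall_lt' _ fun s hs hsD => ?_)
    · obtain ⟨K, hK, r₀, hr₀, h⟩ := hlow t ht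
      exact dimH_le_of_lowerMass hF hK (hD.trans ht.le) hr₀ h
    · obtain ⟨K, hK, r₀, hr₀, h⟩ := hup s hs hsD
      exact le_dimH_of_upperMass hs hr₀ hm hmF h
  · rw [← hofReal, EReal.coe_ennreal_eq_coe_ennreal_iff]
    refine le_antisymm (le_of_forall_gt' _ fun t ht => ?_) (le_of_forall_lt' _ fun s hs hsD => ?_)
    · obtain ⟨K, hK, r₀, hr₀, h⟩ := hlow t ht
      exact packingDim_le_of_lowerMass hK (hD.trans ht.le) hr₀ h
    · obtain ⟨K, hK, r₀, hr₀, h⟩ := hup s hs hsD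
      exact le_packingDim_of_upperMass hF hs hK hr₀ hm h
  · refine le_antisymm ?_ ?_
    · refine ge_of_tendsto ((continuous_coe_real_ereal.tendsto D).mono_left
        (nhdsWithin_le_nhds (s := Set.Ioi D))) ?_
      filter_upwards [self_mem_nhdsWithin] with t ht
      obtain ⟨K, hK, r₀, hr₀, h⟩ := hlow t ht
      exact upperBoxDim_le_of_lowerMass hF hK hr₀ h
    · rcases hD.eq_or_lt with rfl | hD
      · -- For `D = 0` the trivial bound by the total mass gives `0 ≤ upperBoxDim F`.
        refine le_upperBoxDim_of_upperMass (K := m.real Set.univ) (r₀ := 1) hF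
          (hm.trans_le (measureReal_mono (Set.subset_univ _) (measure_ne_top _ _))) one_pos hm
          fun x _ r _ _ => ?_
        rw [Real.rpow_zero, mul_one]
        exact measureReal_mono (Set.subset_univ _) (measure_ne_top _ _)
      refine le_of_tendsto ((continuous_coe_real_ereal.tendsto D).mono_left
        (nhdsWithin_le_nhds (s := Set.Iio D))) ?_
      filter_upwards [Ioo_mem_nhdsLT hD] with s hs
      obtain ⟨K, hK, r₀, hr₀, h⟩ := hup s hs.1 hs.2
      exact le_upperBoxDim_of_upperMass hF hK hr₀ hm h

end PackingUpperMass

/-! ### Ball masses of homogeneous Moran constructions -/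

namespace MoranConstruction

variable {d : ℕ} {n : ℕ → ℕ} (S : MoranConstruction d n)

lemma basicSet_subset_base {k : ℕ} (ω : Word n k) : S.basicSet ω ⊆ S.base := by
  induction k with
  | zero => simp [basicSet, wordMap]
  | succ k ih => exact (S.nested k ω).trans (ih ω.init)

lemma isCompact_base : IsCompact S.base := by
  simpa [wordMap] using S.isCompact_image 0 fun j => j.elim0

lemma totallyBounded_limitSet : TotallyBounded S.limitSet := by
  refine S.isCompact_base.totallyBounded.subset fun x hx => ?_
  obtain ⟨ω, hω⟩ := Set.mem_iUnion.1 (Set.mem_iInter.1 hx 0)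
  exact S.basicSet_subset_base ω hω

variable {S}

/-- Under weak separation each level has exactly one word `ω` with `x ∈ Δ_ω`; by nestedness these
words extend each other, so they are the prefixes of one infinite word. -/
lemma exists_isCodedBy (hS : S.WeaklySeparated) {x : EuclideanSpace ℝ (Fin d)}
    (hx : x ∈ S.limitSet) : ∃ w : Code n, S.IsCodedBy x w := by
  have hω : ∀ k, ∃ ω : Word n k, x ∈ S.basicSet ω := fun k =>
    Set.mem_iUnion.1 (Set.mem_iInter.1 hx k)
  choose ω hω using hω
  have hinit : ∀ k, (ω (k + 1)).init = ω k := by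
    intro k
    by_contra hne
    have : x ∈ (S.basicSet (ω (k + 1)).init ∩ S.basicSet (ω k)) ∩ S.limitSet :=
      ⟨⟨S.nested k _ (hω (k + 1)), hω k⟩, hx⟩
    rw [hS k _ _ hne] at this
    exact this
  let w : Code n := fun j => (ω (j + 1)).last
  have htake : ∀ k, w.take k = ω k := by
    intro k
    induction k with
    | zero => exact funext fun j => j.elim0
    | succ k ih =>
      funext j
      refine Fin.lastCases ?_ (fun i => ?_) j
      · rfl
      · calc w.take (k + 1) i.castSucc = w.take k i := rfl
          _ = ω k i := by rw [ih]
          _ = (ω (k + 1)).init i := by rw [hinit]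
          _ = ω (k + 1) i.castSucc := rfl
  exact ⟨w, fun k => by rw [htake]; exact hω k⟩

lemma cylinderImage_subset_basicSet (w : Code n) (k : ℕ) :
    S.cylinderImage w k ⊆ S.basicSet (w.take k) := by
  rintro y ⟨w', hw', hy⟩
  rw [← hw']
  exact hy k

end MoranConstruction

/-- If `log ψ_n ∼ -λ n`, then `exp (a n) ψ_n ^ b → 0` whenever `a < b λ`. -/
lemma tendsto_exp_mul_rpow {ψ : ℕ → ℝ} (hψ : ∀ k, 0 < ψ k) {lam a b : ℝ}
    (hlim : Tendsto (fun k : ℕ => Real.log (ψ k) / k) atTop (𝓝 (-lam))) (hab : a < b * lam) :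
    Tendsto (fun k : ℕ => Real.exp (a * k) * ψ k ^ b) atTop (𝓝 0) := by
  have h1 : Tendsto (fun k : ℕ => (a + b * (Real.log (ψ k) / k)) * k) atTop atBot := by
    refine Tendsto.neg_mul_atTop (C := a + b * (-lam)) (by linarith) ?_
      tendsto_natCast_atTop_atTop
    exact (hlim.const_mul b).const_add a
  refine (Real.tendsto_exp_atBot.comp h1).congr' ?_
  filter_upwards [eventually_gt_atTop 0] with k hk
  have hk' : (k : ℝ) ≠ 0 := by positivity
  rw [Function.comp, Real.rpow_def_of_pos (hψ k), ← Real.exp_add]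
  congr 1
  field_simp

lemma exists_forall_exp_mul_rpow_le {ψ : ℕ → ℝ} (hψ : ∀ k, 0 < ψ k) {lam a b : ℝ}
    (hlim : Tendsto (fun k : ℕ => Real.log (ψ k) / k) atTop (𝓝 (-lam))) (hab : a < b * lam) :
    ∃ K > 0, ∀ k : ℕ, Real.exp (a * k) * ψ k ^ b ≤ K := by
  obtain ⟨K, hK⟩ := (tendsto_exp_mul_rpow hψ hlim hab).bddAbove_range
  refine ⟨K, ?_, fun k => hK ⟨k, rfl⟩⟩
  exact lt_of_lt_of_le (by have := hψ 0; positivity) (hK ⟨0, rfl⟩)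

lemma tendsto_zero_of_log_div {ψ : ℕ → ℝ} (hψ : ∀ k, 0 < ψ k) {lam : ℝ} (hlam : 0 < lam)
    (hlim : Tendsto (fun k : ℕ => Real.log (ψ k) / k) atTop (𝓝 (-lam))) :
    Tendsto ψ atTop (𝓝 0) := by
  simpa using tendsto_exp_mul_rpow hψ hlim (a := 0) (b := 1) (by simpa using hlam)

section Homogeneous

variable {d q : ℕ} {S : MoranConstruction d fun _ => q} {ψ : ℕ → ℝ}
  {m : Measure (EuclideanSpace ℝ (Fin d))} [IsFiniteMeasure m] {lam L : ℝ}

lemma exp_log_mul_natCast (hq : 1 ≤ q) (k : ℕ) : Real.exp (Real.log q * k) = (q : ℝ) ^ k := by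
  rw [mul_comm, Real.exp_nat_mul, Real.exp_log (by exact_mod_cast hq)]

lemma exp_neg_log_mul_natCast (hq : 1 ≤ q) (k : ℕ) :
    Real.exp (-Real.log q * k) = ((q : ℝ) ^ k)⁻¹ := by
  rw [neg_mul, Real.exp_neg, exp_log_mul_natCast hq]

/-- A ball of radius `r` around a point of `Δ_ω` contains `Δ_ω` as soon as `C ψ_k ≤ r`. For the
first such level `k`, `m (Δ_ω) ≥ L⁻¹ q ^ (-k)` is comparable to `r ^ D` up to an arbitrarily small
loss in the exponent. -/
lemma exists_rpow_le_mul_measureReal_closedBall (hq : 1 ≤ q) (hψ : ∀ k, 0 < ψ k)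
    (hlam : 0 < lam) (hlim : Tendsto (fun k : ℕ => Real.log (ψ k) / k) atTop (𝓝 (-lam)))
    (hL : 0 < L) (hm : ∀ k, 1 ≤ k → ∀ ω : Word (fun _ => q) k,
      L⁻¹ * ((q : ℝ) ^ k)⁻¹ ≤ m.real (S.basicSet ω))
    {C : ℝ} (hC : 0 < C) (hdiam : ∀ k (ω : Word (fun _ => q) k),
      Metric.diam (S.basicSet ω) ≤ C * ψ k)
    {t : ℝ} (ht : Real.log q / lam < t) :
    ∃ K ≥ 0, ∃ r₀ > 0, ∀ x ∈ S.limitSet, ∀ r, 0 < r → r ≤ r₀ →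
      r ^ t ≤ K * m.real (Metric.closedBall x r) := by
  have hq0 : (0 : ℝ) < q := by exact_mod_cast hq
  have ht0 : 0 ≤ t := (div_nonneg (Real.log_natCast_nonneg q) hlam.le).trans ht.le
  obtain ⟨B, hB, hBψ⟩ := exists_forall_exp_mul_rpow_le hψ hlim ((div_lt_iff₀ hlam).1 ht)
  refine ⟨C ^ t * B * q * L, by positivity, C * ψ 0 / 2,
    half_pos (mul_pos hC (hψ 0)), fun x hx r hr hr0 => ?_⟩
  have hex : ∃ k, C * ψ k ≤ r := by
    have h0 : Tendsto (fun k => C * ψ k) atTop (𝓝 0) := by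
      simpa using (tendsto_zero_of_log_div hψ hlam hlim).const_mul C
    obtain ⟨k, hk⟩ := (h0.eventually_lt_const hr).exists
    exact ⟨k, hk.le⟩
  classical
  obtain ⟨k, hk⟩ : ∃ k, Nat.find hex = k + 1 := by
    refine Nat.exists_eq_add_one.2 (Nat.pos_of_ne_zero fun h => ?_)
    have h1 := Nat.find_spec hex
    rw [h] at h1
    linarith [mul_pos hC (hψ 0)]
  have hk1 : C * ψ (k + 1) ≤ r := hk ▸ Nat.find_spec hex
  have hk0 : r < C * ψ k := not_le.1 (Nat.find_min hex (by omega))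
  obtain ⟨ω, hω⟩ := Set.mem_iUnion.1 (Set.mem_iInter.1 hx (k + 1))
  have hsub : S.basicSet ω ⊆ Metric.closedBall x r := fun y hy =>
    (Metric.dist_le_diam_of_mem (S.isCompact_image _ ω).isBounded hy hω).trans
      ((hdiam _ ω).trans hk1)
  have hmass : L⁻¹ * ((q : ℝ) ^ (k + 1))⁻¹ ≤ m.real (Metric.closedBall x r) :=
    (hm _ (by omega) ω).trans (measureReal_mono hsub (measure_ne_top _ _))
  have hBk := hBψ k
  rw [exp_log_mul_natCast hq] at hBk
  calc r ^ t ≤ (C * ψ k) ^ t := Real.rpow_le_rpow hr.le hk0.le ht0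
    _ = C ^ t * ψ k ^ t := Real.mul_rpow hC.le (hψ k).le
    _ ≤ C ^ t * (B * ((q : ℝ) ^ k)⁻¹) := by
        gcongr
        rw [← div_eq_mul_inv, le_div_iff₀ (by positivity)]
        linarith
    _ = C ^ t * B * q * L * (L⁻¹ * ((q : ℝ) ^ (k + 1))⁻¹) := by
        field_simp
        ring
    _ ≤ _ := by gcongr

/-- A ball of radius `r` centred in `F` meets boundedly many elements of the Moran covering at
scale `r`; each of them lies in some `Δ_ω` with `ψ_{k + 1} ≤ r`, whose mass is at most
`L q ^ (-k)`, and this is comparable to `r ^ D` up to an arbitrarily small loss in the exponent. -/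
lemma exists_measureReal_closedBall_le (hq : 1 ≤ q) (hψ : ∀ k, 0 < ψ k) (hψanti : StrictAnti ψ)
    (hψ0 : ψ 0 = 1)
    (hlam : 0 < lam) (hlim : Tendsto (fun k : ℕ => Real.log (ψ k) / k) atTop (𝓝 (-lam)))
    (hL : 0 < L) (hm : ∀ k, 1 ≤ k → ∀ ω : Word (fun _ => q) k,
      m.real (S.basicSet ω) ≤ L * ((q : ℝ) ^ k)⁻¹)
    (hmF : m S.limitSetᶜ = 0) (hS : S.WeaklySeparated)
    {c : (j : ℕ) → Fin q → ℝ} (hc : ∀ k (ω : Word (fun _ => q) k), vec c ω = ψ k)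
    (hLE : IsLowerEstimating S c)
    {s : ℝ} (hs0 : 0 < s) (hs : s < Real.log q / lam) :
    ∃ K > 0, ∃ r₀ > 0, ∀ x ∈ S.limitSet, ∀ r, 0 ≤ r → r ≤ r₀ →
      m.real (Metric.closedBall x r) ≤ K * r ^ s := by
  have hq0 : (0 : ℝ) < q := by exact_mod_cast hq
  obtain ⟨B, hB, hBψ⟩ := exists_forall_exp_mul_rpow_le hψ hlim (a := -Real.log q) (b := -s)
    (by linarith [(lt_div_iff₀ hlam).1 hs])
  obtain ⟨N, hN⟩ := hLE
  -- The bound for open balls with the radius of the Moran covering.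
  have hball : ∀ x ∈ S.limitSet, ∀ r, 0 < r → r < ψ 1 →
      m.real (Metric.ball x r) ≤ (N + 1) * (L * (q * B)) * r ^ s := by
    intro x hx r hr hr1
    have hpiece : ∀ P ∈ moranCovering S c r, m.real P ≤ L * (q * B) * r ^ s := by
      rintro P ⟨w, k, hk, hk', rfl⟩
      rw [hc] at hk hk'
      have hk1 : 1 ≤ k := by
        have := hψanti.lt_iff_gt.1 (hk'.trans_lt hr1)
        omega
      have hBk := hBψ (k + 1)
      rw [exp_neg_log_mul_natCast hq, Real.rpow_neg (hψ _).le, ← mul_inv,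
        inv_le_iff_one_le_mul₀ (by have := hψ (k + 1); positivity)] at hBk
      have hpow : ((q : ℝ) ^ k)⁻¹ ≤ q * B * r ^ s := by
        rw [inv_le_iff_one_le_mul₀ (by positivity)]
        calc (1 : ℝ) ≤ B * ((q : ℝ) ^ (k + 1) * ψ (k + 1) ^ s) := hBk
          _ ≤ B * ((q : ℝ) ^ (k + 1) * r ^ s) := by
              have := (hψ (k + 1)).le
              gcongr
          _ = _ := by ring
      calc m.real (S.cylinderImage w k) ≤ m.real (S.basicSet (w.take k)) :=
            measureReal_mono (S.cylinderImage_subset_basicSet w k) (measure_ne_top _ _)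
        _ ≤ L * ((q : ℝ) ^ k)⁻¹ := hm k hk1 _
        _ ≤ L * (q * B * r ^ s) := by gcongr
        _ = _ := by ring
    have hr1' : r < 1 := hr1.trans (hψ0 ▸ hψanti one_pos)
    have hNr := hN x hx r hr hr1'
    set Q := {P ∈ moranCovering S c r | (P ∩ Metric.ball x r).Nonempty} with hQ
    have hQfin : Q.Finite := Set.encard_ne_top_iff.1 (hNr.trans_le le_top).ne
    have hcard : hQfin.toFinset.card ≤ N := by
      rw [hQfin.encard_eq_coe_toFinset_card] at hNr
      exact_mod_cast hNr.le
    have hcover : Metric.ball x r ∩ S.limitSet ⊆ ⋃ P ∈ hQfin.toFinset, P := by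
      rintro y ⟨hyb, hyF⟩
      obtain ⟨w, hw⟩ := S.exists_isCodedBy hS hyF
      have hex : ∃ k, ψ k ≤ r := by
        obtain ⟨k, hk⟩ :=
          ((tendsto_zero_of_log_div hψ hlam hlim).eventually_lt_const hr).exists
        exact ⟨k, hk.le⟩
      classical
      obtain ⟨k, hk⟩ : ∃ k, Nat.find hex = k + 1 := by
        refine Nat.exists_eq_add_one.2 (Nat.pos_of_ne_zero fun h => ?_)
        have h1 := Nat.find_spec hex
        rw [h, hψ0] at h1
        linarith
      have hk1 : ψ (k + 1) ≤ r := hk ▸ Nat.find_spec hex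
      have hk0 : r < ψ k := not_le.1 (Nat.find_min hex (by omega))
      have hy : y ∈ S.cylinderImage w k := ⟨w, rfl, hw⟩
      refine Set.mem_iUnion₂.2 ⟨S.cylinderImage w k, hQfin.mem_toFinset.2 ⟨⟨w, k, ?_, ?_, rfl⟩,
        ⟨y, hy, hyb⟩⟩, hy⟩
      · rwa [hc]
      · rwa [hc]
    calc m.real (Metric.ball x r) ≤ m.real (Metric.ball x r ∩ S.limitSet ∪ S.limitSetᶜ) :=
          measureReal_mono (fun y hy => by
            by_cases hyF : y ∈ S.limitSet
            · exact Or.inl ⟨hy, hyF⟩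
            · exact Or.inr hyF) (measure_ne_top _ _)
      _ ≤ m.real (Metric.ball x r ∩ S.limitSet) + m.real S.limitSetᶜ := measureReal_union_le _ _
      _ = m.real (Metric.ball x r ∩ S.limitSet) := by simp [Measure.real, hmF]
      _ ≤ m.real (⋃ P ∈ hQfin.toFinset, P) := measureReal_mono hcover (measure_ne_top _ _)
      _ ≤ ∑ P ∈ hQfin.toFinset, m.real P := measureReal_biUnion_finset_le _ _
      _ ≤ ∑ P ∈ hQfin.toFinset, L * (q * B) * r ^ s :=
          Finset.sum_le_sum fun P hP => hpiece P (hQfin.mem_toFinset.1 hP).1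
      _ = hQfin.toFinset.card * (L * (q * B) * r ^ s) := by simp
      _ ≤ (N + 1) * (L * (q * B) * r ^ s) := by
          gcongr
          exact (Nat.cast_le.2 hcard).trans (by linarith)
      _ = _ := by ring
  refine ⟨(N + 1) * (L * (q * B)) * 2 ^ s, by positivity, ψ 1 / 4, by have := hψ 1; positivity,
    fun x hx r hr hr1 => ?_⟩
  have hψ1 := hψ 1
  rcases hr.eq_or_lt with rfl | hr
  · -- Radius `0`: let the radius of the open ball tend to `0`.
    rw [Real.zero_rpow hs0.ne', mul_zero]
    have hlim0 : Tendsto (fun r : ℝ => (N + 1) * (L * (q * B)) * r ^ s) (𝓝[>] 0) (𝓝 0) := by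
      have h1 : Tendsto (fun r : ℝ => r ^ s) (𝓝 0) (𝓝 (0 ^ s)) :=
        (Real.continuous_rpow_const hs0.le).tendsto 0
      rw [Real.zero_rpow hs0.ne'] at h1
      simpa using (h1.mono_left nhdsWithin_le_nhds).const_mul ((N + 1) * (L * (q * B)))
    refine ge_of_tendsto hlim0 ?_
    filter_upwards [Ioo_mem_nhdsGT hψ1] with r hr
    exact (measureReal_mono (Metric.closedBall_subset_ball hr.1) (measure_ne_top _ _)).trans
      (hball x hx r hr.1 hr.2)
  · calc m.real (Metric.closedBall x r) ≤ m.real (Metric.ball x (2 * r)) :=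
          measureReal_mono (Metric.closedBall_subset_ball (by linarith)) (measure_ne_top _ _)
      _ ≤ (N + 1) * (L * (q * B)) * (2 * r) ^ s := hball x hx _ (by linarith) (by linarith)
      _ = _ := by rw [Real.mul_rpow zero_le_two hr.le]; ring

/-- For ratios `c_j` common to all branches, the sum in the Gibbs condition is `q ^ k ψ_k ^ β`, so
the condition says that `m (Δ_ω)` is comparable to `q ^ (-k)`. The exponent plays no role and is
taken to be `1`. -/
lemma exists_measure_comparable_inv_pow {c : (j : ℕ) → Fin q → ℝ} (hψ : ∀ k, 0 < ψ k)
    (hc : ∀ k (ω : Word (fun _ => q) k), vec c ω = ψ k) (h : HasGibbsLikeMeasures S c) :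
    ∃ m : Measure (EuclideanSpace ℝ (Fin d)), IsFiniteMeasure m ∧ m S.limitSetᶜ = 0 ∧
      ∃ L > 0, ∀ k, 1 ≤ k → ∀ ω : Word (fun _ => q) k,
        L⁻¹ * ((q : ℝ) ^ k)⁻¹ ≤ m.real (S.basicSet ω) ∧
        m.real (S.basicSet ω) ≤ L * ((q : ℝ) ^ k)⁻¹ := by
  obtain ⟨m, hmfin, hmF, L, hL, hm⟩ := h 1 one_pos
  refine ⟨m, hmfin, hmF, L, hL, fun k hk ω => ?_⟩
  obtain ⟨h1, h2⟩ := hm k hk ω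
  have hψk := hψ k
  simp only [hc, Real.rpow_one, Finset.sum_const, Finset.card_univ, Fintype.card_pi,
    Fintype.card_fin, Finset.prod_const, nsmul_eq_mul, Nat.cast_pow] at h1 h2
  rw [← div_div, div_le_div_iff_of_pos_right hψk, div_eq_mul_inv] at h1 h2
  exact ⟨h1, h2⟩

/-- The dimension formula for a fixed homogeneous Moran construction with `log ψ_k ∼ -λ k`. -/
theorem dimensions_eq_of_homogeneous (hq : 1 ≤ q) (hψ : ∀ k, 0 < ψ k) (hψanti : StrictAnti ψ)
    (hψ0 : ψ 0 = 1)
    (hlam : 0 < lam) (hlim : Tendsto (fun k : ℕ => Real.log (ψ k) / k) atTop (𝓝 (-lam)))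
    {c : (j : ℕ) → Fin q → ℝ} (hc : ∀ k (ω : Word (fun _ => q) k), vec c ω = ψ k)
    (hS : S.WeaklySeparated) (hUE : IsUpperEstimating S c) (hLE : IsLowerEstimating S c)
    (hA3 : HasGibbsLikeMeasures S c) :
    ((dimH S.limitSet : ℝ≥0∞) : EReal) = ((Real.log q / lam : ℝ) : EReal) ∧
      ((packingDim S.limitSet : ℝ≥0∞) : EReal) = ((Real.log q / lam : ℝ) : EReal) ∧
      upperBoxDim S.limitSet = ((Real.log q / lam : ℝ) : EReal) := by
  obtain ⟨m, hmfin, hmF, L, hL, hm⟩ := exists_measure_comparable_inv_pow hψ hc hA3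
  obtain ⟨C, hC, hdiam⟩ := hUE
  simp only [hc] at hdiam
  have hq0 : (0 : ℝ) < q := by exact_mod_cast hq
  have hmpos : 0 < m.real S.limitSet := by
    have h1 := (hm 1 le_rfl fun _ => ⟨0, hq⟩).1
    have h2 : 0 < m.real Set.univ := lt_of_lt_of_le (by positivity)
      (h1.trans (measureReal_mono (Set.subset_univ _) (measure_ne_top _ _)))
    refine h2.trans_le ?_
    rw [← Set.union_compl_self S.limitSet]
    refine (measureReal_union_le _ _).trans_eq ?_
    simp [Measure.real, hmF]
  exact dimensions_eq_of_ballMass S.totallyBounded_limitSet hmpos hmF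
    (div_nonneg (Real.log_natCast_nonneg q) hlam.le)
    (fun t ht => exists_rpow_le_mul_measureReal_closedBall hq hψ hlam hlim hL
      (fun k hk ω => (hm k hk ω).1) hC hdiam ht)
    (fun s hs0 hs => exists_measureReal_closedBall_le hq hψ hψanti hψ0 hlam hlim hL
      (fun k hk ω => (hm k hk ω).2) hmF hS hc hLE hs0 hs)

end Homogeneous

end MoranSet

/-! ### Stochastic ratios -/

theorem mainTheorem5 {M : Type*} [MeasurableSpace M] (μ : Measure M) [IsProbabilityMeasure μ]
    (T : M → M) (hT : Ergodic T μ)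
    (φ : M → ℝ) (hφ : ∀ x, 0 ≤ φ x ∧ φ x < 1) (hφ_pos : ∀ᵐ x ∂μ, 0 < φ x)
    (hlog : Integrable (fun x => Real.log (φ x)) μ) (hneg : ∫ x, Real.log (φ x) ∂μ < 0)
    (d q : ℕ) (hq : 1 ≤ q) :
    ∀ᵐ x ∂μ, ∀ S : MoranSet.MoranConstruction d (fun _ => q),
      S.WeaklySeparated →
      MoranSet.IsBasic (MoranSet.stochasticRatios T φ x (fun _ => q)) →
      MoranSet.IsUpperEstimating S (MoranSet.stochasticRatios T φ x (fun _ => q)) →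
      MoranSet.IsLowerEstimating S (MoranSet.stochasticRatios T φ x (fun _ => q)) →
      MoranSet.HasGibbsLikeMeasures S (MoranSet.stochasticRatios T φ x (fun _ => q)) →
      ((dimH S.limitSet : ℝ≥0∞) : EReal)
          = ((-Real.log q / ∫ y, Real.log (φ y) ∂μ : ℝ) : EReal) ∧
      ((MoranSet.packingDim S.limitSet : ℝ≥0∞) : EReal)
          = ((-Real.log q / ∫ y, Real.log (φ y) ∂μ : ℝ) : EReal) ∧
      MoranSet.upperBoxDim S.limitSet
          = ((-Real.log q / ∫ y, Real.log (φ y) ∂μ : ℝ) : EReal) := by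
  have hmp := hT.toMeasurePreserving
  have hpos : ∀ᵐ x ∂μ, ∀ j : ℕ, 0 < φ (T^[j + 1] x) :=
    ae_all_iff.2 fun j => (hmp.iterate (j + 1)).quasiMeasurePreserving.ae hφ_pos
  have hbirk := hmp.quasiMeasurePreserving.ae (ae_tendsto_birkhoffAverage hT hlog)
  filter_upwards [hpos, hbirk] with x hx hlim S hS _ hUE hLE hA3
  set ψ : ℕ → ℝ := fun k => ∏ j ∈ Finset.range k, φ (T^[j + 1] x) with hψdef
  have hψ : ∀ k, 0 < ψ k := fun k => Finset.prod_pos fun j _ => hx j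
  have hanti : StrictAnti ψ := strictAnti_nat_of_succ_lt fun k => by
    simp only [hψdef, Finset.prod_range_succ]
    exact mul_lt_of_lt_one_right (hψ k) (hφ _).2
  have hlogψ : Tendsto (fun k : ℕ => Real.log (ψ k) / k) atTop
      (𝓝 (-(-∫ y, Real.log (φ y) ∂μ))) := by
    rw [neg_neg]
    refine hlim.congr fun k => ?_
    rw [hψdef, Real.log_prod (fun j _ => (hx j).ne'), birkhoffAverage, birkhoffSum, smul_eq_mul,
      div_eq_inv_mul]
    simp only [Function.iterate_succ_apply]
  have hc : ∀ k (ω : MoranSet.Word (fun _ => q) k),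
      MoranSet.vec (MoranSet.stochasticRatios T φ x (fun _ => q)) ω = ψ k := fun k ω =>
    Fin.prod_univ_eq_prod_range (fun j => φ (T^[j + 1] x)) k
  have h := MoranSet.dimensions_eq_of_homogeneous hq hψ hanti (by simp [hψdef])
    (neg_pos.2 hneg) hlogψ hc hS hUE hLE hA3
  rwa [div_neg, ← neg_div] at h
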